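/- Let $n \ge 3$ and let $L_n$ be the Laplacian matrix of the path graph $P_n$ on $n$ vertices. For $k\in\{1,2\}$ and real $\varepsilon$, let $$\lambda_{\min}(k)(\varepsilon) \;=\; \max_{S\subseteq\{1,\dots,n\},\ |S|=k}\Big[\lambda_{\min}\Big(L_n+\varepsilon\sum_{j\in S}e_je_j^{T}\Big)-\lambda_{\min}(L_n)\Big]$$ be the optimal $k$-port shift of the smallest Laplacian eigenvalue. Then there are real numbers $a_1,a_2$ (depending only on $n$) such that, as $\varepsilon\to0$, $$\lambda_{\min}(1)(\varepsilon)=\frac{\varepsilon}{n}-a_1\varepsilon^2+O(\varepsilon^3),\qquad \lambda_{\min}(2)(\varepsilon)=\frac{2\varepsilon}{n}-a_2\varepsilon^2+O(\varepsilon^3),$$ where $$a_1=\begin{cases}\frac{n^2-1}{12n^2}& n \text{ odd},\\[2pt] \frac{n^2+2}{12n^2}& n\text{ even,}\end{cases}\qquad a_2=\begin{cases}\frac{n^2-1}{12n^2}& n \text{ odd},\\[2pt] \frac{n^2-4}{12n^2}& n\equiv 2 \pmod 4,\\[2pt] \frac{n^2+8}{12n^2}& n\equiv 0\pmod 4.\end{cases}$$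 Up to second order in $\varepsilon$, the optimal 2-port shift is strictly more than twice the optimal 1-port shift: for every $\varepsilon\neq0$, $$\frac{2\varepsilon}{n}-a_2\varepsilon^2\;>\;2\Big(\frac{\varepsilon}{n}-a_1\varepsilon^2\Big).$$ The difference of the two sides equals $\varepsilon^2\,\frac{n^2+2}{12n^2}$ up to an error of absolute value at most $\frac{\varepsilon^2}{2n^2}$. Consequently $\lambda_{\min}(2)(\varepsilon)>2\,\lambda_{\min}(1)(\varepsilon)$ for all sufficiently small $\varepsilon\ne0$ (how small may depend on $n$). -/

import Mathlib

open Filter Topology Asymptotics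

/-- The smallest eigenvalue of a real symmetric matrix. -/
noncomputable def minEigenvalue {V : Type*} [Fintype V] [DecidableEq V]
    (A : Matrix V V ℝ) : ℝ :=
  sInf (spectrum ℝ A)

/-- For a symmetric matrix of positive size, `minEigenvalue` is attained: it is an eigenvalue, and
no eigenvalue is smaller. -/
theorem minEigenvalue_isLeast {V : Type*} [Fintype V] [DecidableEq V] [Nonempty V]
    {A : Matrix V V ℝ} (hA : A.IsHermitian) : IsLeast (spectrum ℝ A) (minEigenvalue A) := by
  have h : spectrum ℝ A = Set.range hA.eigenvalues := hA.spectrum_real_eq_range_eigenvalues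
  have hfin : (spectrum ℝ A).Finite := by
    rw [h]; exact Set.finite_range _
  have hne : (spectrum ℝ A).Nonempty := by
    rw [h]; exact Set.range_nonempty _
  exact ⟨hne.csInf_mem hfin, fun x hx => csInf_le hfin.bddBelow hx⟩

/-- The Laplacian of `G` with its diagonal entries at the ports `j ∈ S` perturbed by `ε`:
`L + ε ∑_{j ∈ S} e_j e_jᵀ`. -/
noncomputable def perturbedLaplacian {V : Type*} [Fintype V] [DecidableEq V]
    (G : SimpleGraph V) [DecidableRel G.Adj] (S : Finset V) (ε : ℝ) : Matrix V V ℝ :=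
  G.lapMatrix ℝ + ε • ∑ j ∈ S, Matrix.single j j (1 : ℝ)

/-- The shift of the smallest Laplacian eigenvalue caused by the perturbation at the ports `S`. -/
noncomputable def eigenvalueShift {V : Type*} [Fintype V] [DecidableEq V]
    (G : SimpleGraph V) [DecidableRel G.Adj] (S : Finset V) (ε : ℝ) : ℝ :=
  minEigenvalue (perturbedLaplacian G S ε) - minEigenvalue (G.lapMatrix ℝ)

/-- The optimal `k`-port shift: the maximum of the shift over all sets of exactly `k` ports
(a finite family, nonempty for `k ≤ |V|`). -/
noncomputable def optimalShift {V : Type*} [Fintype V] [DecidableEq V]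
    (G : SimpleGraph V) [DecidableRel G.Adj] (k : ℕ) (ε : ℝ) : ℝ :=
  ⨆ S : {S : Finset V // S.card = k}, eigenvalueShift G S.1 ε

/-- `c₁ ε + c₂ ε²` is the approximation of `f ε` up to second order as `ε → 0`. -/
def HasSecondOrderApprox (f : ℝ → ℝ) (c₁ c₂ : ℝ) : Prop :=
  (fun ε : ℝ => f ε - (c₁ * ε + c₂ * ε ^ 2)) =O[𝓝 0] fun ε : ℝ => ε ^ 3

/-- Adjacency in the path graph is decidable: `u` and `v` are adjacent iff they are consecutive. -/
instance pathGraphDecidableAdj (n : ℕ) : DecidableRel (SimpleGraph.pathGraph n).Adj :=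
  fun _ _ => decidable_of_iff' _ SimpleGraph.pathGraph_adj

/-- The perturbed Laplacian is symmetric. -/
theorem perturbedLaplacian_isHermitian {V : Type*} [Fintype V] [DecidableEq V]
    (G : SimpleGraph V) [DecidableRel G.Adj] (S : Finset V) (ε : ℝ) :
    (perturbedLaplacian G S ε).IsHermitian := by
  have h : (∑ j ∈ S, Matrix.single j j (1 : ℝ)).IsHermitian := by
    simp [Matrix.IsHermitian, Matrix.transpose_sum]
  have h2 : (ε • ∑ j ∈ S, Matrix.single j j (1 : ℝ)).IsHermitian := by
    rw [Matrix.IsHermitian, Matrix.conjTranspose_smul, h.eq]; simp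
  exact (G.isHermitian_lapMatrix (R := ℝ)).add h2

/-! The constant vector spans the kernel of the path Laplacian `L`, so formal perturbation theory
gives the shift `aε - cε²` with `a = |S|/n` and `c = ⟨1_S, x⟩/n`, where `x` has zero sum and `L x =
1_S - a`. The truncated eigenvector is positive for small `ε` and has residual `O(ε³)`. Off-diagonal
entries are nonpositive, so `abs_minEigenvalue_sub_le` turns this residual into an eigenvalue error
without any analyticity of eigenvalues.

On a path, `x` is the potential of an explicit flow `Φ`, and summation by parts turns `⟨1_S, x⟩`
into `∑ Φ²`, which is `portEnergy S / n²`. As `a` depends only on `|S|`, the optimal shift is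
governed by the least energy, whatever the sign of `ε`. Each summand of the energy is least when the
port count is an integer nearest to `|S|(i+1)/n`. One port at the middle, or two near the quarter
points, achieve this at all positions at once; their energies give the coefficients. -/

/-! ### Perturbation of the smallest eigenvalue -/

/-- Two-sided Collatz–Wielandt bound: a positive approximate eigenvector of a symmetric matrix with
nonpositive off-diagonal entries locates the smallest eigenvalue. -/
theorem abs_minEigenvalue_sub_le {V : Type*} [Fintype V] [DecidableEq V] [Nonempty V]
    {A : Matrix V V ℝ} (hA : A.IsHermitian) (hoff : ∀ i j, i ≠ j → A i j ≤ 0)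
    {u : V → ℝ} (hu : ∀ i, 0 < u i) {μ δ : ℝ}
    (h : ∀ i, |A.mulVec u i - μ * u i| ≤ δ * u i) : |minEigenvalue A - μ| ≤ δ := by
  have hleast := minEigenvalue_isLeast hA
  set l := minEigenvalue A with hl
  rw [abs_le]
  constructor
  · have hmem := hleast.1
    rw [hA.spectrum_real_eq_range_eigenvalues] at hmem
    obtain ⟨k, hk⟩ := hmem
    have hev := hA.mulVec_eigenvectorBasis k
    set w : V → ℝ := ⇑(hA.eigenvectorBasis k) with hw
    have hw0 : w ≠ 0 := by
      intro h0
      have h1 := hA.eigenvectorBasis.orthonormal.ne_zero k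
      apply h1
      ext i
      exact congrFun h0 i
    rw [hk] at hev
    -- Where `|w|/u` is largest, `M • u` touches `|w|` from above; nonpositive off-diagonal entries
    -- then give `A (M • u) ≤ l • (M • u)` at this index.
    obtain ⟨i, -, hi⟩ := Finset.exists_max_image Finset.univ (fun i => |w i| / u i)
      Finset.univ_nonempty
    have hmax : ∀ j, |w j| ≤ |w i| / u i * u j := fun j =>
      (div_le_iff₀ (hu j)).1 (hi j (Finset.mem_univ j))
    set M := |w i| / u i with hM
    have hMi : |w i| = M * u i := by rw [hM, div_mul_cancel₀ _ (hu i).ne']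
    have hMpos : 0 < M := by
      obtain ⟨j, hj⟩ := Function.ne_iff.1 hw0
      have h1 : 0 < |w j| := abs_pos.2 hj
      by_contra hneg
      have := hmax j
      nlinarith [hu j]
    obtain ⟨s, hs, hswi⟩ : ∃ s : ℝ, |s| = 1 ∧ s * w i = |w i| := by
      rcases abs_cases (w i) with h1 | h1
      · exact ⟨1, by simp, by rw [h1.1, one_mul]⟩
      · exact ⟨-1, by simp, by rw [h1.1]; ring⟩
    have hkey : M * A.mulVec u i ≤ l * (M * u i) := by
      have h1 : l * (M * u i) = ∑ j, A i j * (s * w j) := by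
        have h2 := congrFun hev i
        simp only [Pi.smul_apply, smul_eq_mul, Matrix.mulVec, dotProduct] at h2
        calc l * (M * u i) = s * (l * w i) := by rw [← hMi, ← hswi]; ring
          _ = ∑ j, A i j * (s * w j) := by
            rw [← h2, Finset.mul_sum]
            exact Finset.sum_congr rfl fun j _ => by ring
      rw [h1, Matrix.mulVec, dotProduct, Finset.mul_sum]
      refine Finset.sum_le_sum fun j _ => ?_
      by_cases hij : i = j
      · subst hij
        rw [hswi, hMi]
        exact le_of_eq (by ring)
      · have h3 : s * w j ≤ M * u j :=
          (le_abs_self _).trans (by rw [abs_mul, hs, one_mul]; exact hmax j)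
        calc M * (A i j * u j) = A i j * (M * u j) := by ring
          _ ≤ A i j * (s * w j) := mul_le_mul_of_nonpos_left h3 (hoff i j hij)
    have h4 := (abs_le.1 (h i)).1
    have h5 : A.mulVec u i ≤ l * u i := by
      refine le_of_mul_le_mul_left ?_ hMpos
      calc _ ≤ _ := hkey
        _ = _ := by ring
    have h6 : (-δ) * u i ≤ (l - μ) * u i := by linarith
    exact le_of_mul_le_mul_right h6 (hu i)
  -- The upper bound is the Rayleigh quotient of `u`.
  · have hpsd : (A - l • (1 : Matrix V V ℝ)).PosSemidef := by
      have hH : (A - l • (1 : Matrix V V ℝ)).IsHermitian :=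
        hA.sub (by simp [Matrix.IsHermitian])
      refine (Matrix.posSemidef_iff_isHermitian_and_spectrum_nonneg).2 ⟨hH, ?_⟩
      intro a ha
      have h1 : a + l ∈ spectrum ℝ A := by
        rw [← Algebra.algebraMap_eq_smul_one, ← spectrum.sub_singleton_eq] at ha
        obtain ⟨b, hb, c, hc, rfl⟩ := ha
        rw [Set.mem_singleton_iff] at hc
        simpa [hc] using hb
      have := hleast.2 h1
      change 0 ≤ a
      linarith
    have h0 := hpsd.dotProduct_mulVec_nonneg u
    rw [Matrix.sub_mulVec, Matrix.smul_mulVec, Matrix.one_mulVec] at h0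
    simp only [star_trivial, dotProduct, Pi.sub_apply, Pi.smul_apply, smul_eq_mul] at h0
    have h1 : ∑ i, u i * (A.mulVec u i - l * u i) ≤ ∑ i, (μ + δ - l) * (u i) ^ 2 := by
      refine Finset.sum_le_sum fun i _ => ?_
      have := (abs_le.1 (h i)).2
      nlinarith [hu i]
    rw [← Finset.mul_sum] at h1
    have h2 : 0 < ∑ i, (u i) ^ 2 :=
      Finset.sum_pos (fun i _ => pow_pos (hu i) 2) Finset.univ_nonempty
    have := nonneg_of_mul_nonneg_left (h0.trans h1) h2
    linarith

theorem perturbedLaplacian_offDiag_nonpos {V : Type*} [Fintype V] [DecidableEq V]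
    (G : SimpleGraph V) [DecidableRel G.Adj] (S : Finset V) (ε : ℝ) {i j : V} (hij : i ≠ j) :
    perturbedLaplacian G S ε i j ≤ 0 := by
  have h : (∑ k ∈ S, Matrix.single k k (1 : ℝ)) i j = 0 := by
    rw [Matrix.sum_apply]
    refine Finset.sum_eq_zero fun k _ => ?_
    rw [Matrix.single_apply, if_neg]
    rintro ⟨rfl, h⟩
    exact hij h
  simp only [perturbedLaplacian, Matrix.add_apply, Matrix.smul_apply, h, SimpleGraph.lapMatrix,
    Matrix.sub_apply, SimpleGraph.degMatrix, Matrix.diagonal_apply_ne _ hij,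
    SimpleGraph.adjMatrix_apply]
  split_ifs <;> simp

theorem perturbedLaplacian_mulVec_apply {V : Type*} [Fintype V] [DecidableEq V]
    (G : SimpleGraph V) [DecidableRel G.Adj] (S : Finset V) (ε : ℝ) (u : V → ℝ) (i : V) :
    (perturbedLaplacian G S ε).mulVec u i =
      (G.lapMatrix ℝ).mulVec u i + ε * if i ∈ S then u i else 0 := by
  rw [perturbedLaplacian, Matrix.add_mulVec, Matrix.smul_mulVec, Matrix.sum_mulVec]
  simp [Finset.sum_apply, Matrix.single_mulVec, Function.update_apply]

theorem minEigenvalue_lapMatrix {V : Type*} [Fintype V] [DecidableEq V] [Nonempty V]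
    (G : SimpleGraph V) [DecidableRel G.Adj] : minEigenvalue (G.lapMatrix ℝ) = 0 := by
  have h0 : perturbedLaplacian G ∅ 0 = G.lapMatrix ℝ := by simp [perturbedLaplacian]
  have h := abs_minEigenvalue_sub_le (A := G.lapMatrix ℝ) (u := fun _ => 1) (μ := 0) (δ := 0)
    (G.isHermitian_lapMatrix (R := ℝ))
    (fun i j hij => h0 ▸ perturbedLaplacian_offDiag_nonpos G ∅ 0 hij) (fun _ => one_pos)
    (fun i => by
      have := congrFun (G.lapMatrix_mulVec_const_eq_zero (R := ℝ)) i
      simp only [Pi.zero_apply] at this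
      simp [this])
  simpa using h

/-- Second-order perturbation theory for the smallest eigenvalue of a Laplacian, given the solutions
`x` and `y` of the first two correction equations. -/
theorem eigenvalueShift_hasSecondOrderApprox {V : Type*} [Fintype V] [DecidableEq V] [Nonempty V]
    (G : SimpleGraph V) [DecidableRel G.Adj] (S : Finset V) (a c : ℝ) (x y : V → ℝ)
    (hx : ∀ i, (G.lapMatrix ℝ).mulVec x i = (if i ∈ S then 1 else 0) - a)
    (hy : ∀ i, (G.lapMatrix ℝ).mulVec y i = (if i ∈ S then x i else 0) - c - a * x i) :
    HasSecondOrderApprox (eigenvalueShift G S) a (-c) := by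
  set u : ℝ → V → ℝ := fun ε => (fun _ => 1) - ε • x + ε ^ 2 • y with hu
  set p : V → ℝ → ℝ := fun i ε =>
    (if i ∈ S then y i else 0) - c * x i - a * y i + ε * (c * y i) with hp
  have hone : ∀ i, (G.lapMatrix ℝ).mulVec (fun _ => 1) i = 0 := fun i =>
    congrFun (G.lapMatrix_mulVec_const_eq_zero (R := ℝ)) i
  have hres : ∀ ε i, (perturbedLaplacian G S ε).mulVec (u ε) i - (a * ε - c * ε ^ 2) * u ε i
      = ε ^ 3 * p i ε := by
    intro ε i
    rw [perturbedLaplacian_mulVec_apply]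
    simp only [hu, Matrix.mulVec_add, Matrix.mulVec_sub, Matrix.mulVec_smul, Pi.add_apply,
      Pi.sub_apply, Pi.smul_apply, smul_eq_mul, hx, hy, hone, hp]
    split_ifs <;> ring
  -- The added 1 makes `|p i 0| < C * u 0 i` strict, so it persists near `ε = 0` by continuity.
  set C : ℝ := 1 + ∑ i, |p i 0| with hC
  have hevent : ∀ᶠ ε in 𝓝 (0 : ℝ), ∀ i, 0 < u ε i ∧ |p i ε| < C * u ε i := by
    refine eventually_all.2 fun i => ?_
    have hcu : Continuous fun ε : ℝ => u ε i := by
      simp only [hu, Pi.add_apply, Pi.sub_apply, Pi.smul_apply, smul_eq_mul]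
      fun_prop
    have hcp : Continuous fun ε : ℝ => p i ε := by
      simp only [hp]
      fun_prop
    have hu0 : u 0 i = 1 := by simp [hu]
    refine Filter.Eventually.and ?_ ?_
    · exact continuousAt_const.eventually_lt hcu.continuousAt (by rw [hu0]; exact one_pos)
    · refine hcp.abs.continuousAt.eventually_lt (hcu.const_mul C).continuousAt ?_
      rw [hu0, mul_one, hC]
      have := Finset.single_le_sum (f := fun i => |p i 0|) (fun i _ => abs_nonneg _)
        (Finset.mem_univ i)
      linarith
  refine IsBigO.of_bound C ?_
  filter_upwards [hevent] with ε hε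
  have h := abs_minEigenvalue_sub_le (perturbedLaplacian_isHermitian G S ε)
    (fun i j hij => perturbedLaplacian_offDiag_nonpos G S ε hij) (fun i => (hε i).1)
    (μ := a * ε - c * ε ^ 2) (δ := C * |ε ^ 3|) (fun i => by
      rw [hres, abs_mul]
      calc |ε ^ 3| * |p i ε| ≤ |ε ^ 3| * (C * u ε i) :=
            mul_le_mul_of_nonneg_left (hε i).2.le (abs_nonneg _)
        _ = _ := by ring)
  rw [eigenvalueShift, minEigenvalue_lapMatrix, Real.norm_eq_abs, Real.norm_eq_abs]
  convert h using 2
  ring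

/-- If all shifts have the same first-order coefficient, the optimal shift has the largest
second-order coefficient. -/
theorem optimalShift_hasSecondOrderApprox {V : Type*} [Fintype V] [DecidableEq V]
    (G : SimpleGraph V) [DecidableRel G.Adj] (k : ℕ) (a : ℝ) (c : Finset V → ℝ)
    (h : ∀ S : Finset V, S.card = k → HasSecondOrderApprox (eigenvalueShift G S) a (-c S))
    (T : Finset V) (hT : T.card = k) (hmin : ∀ S : Finset V, S.card = k → c T ≤ c S) :
    HasSecondOrderApprox (optimalShift G k) a (-c T) := by
  have : Nonempty {S : Finset V // S.card = k} := ⟨⟨T, hT⟩⟩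
  have h' : ∀ S : {S : Finset V // S.card = k}, ∃ C : ℝ, ∀ᶠ ε in 𝓝 (0 : ℝ),
      |eigenvalueShift G S.1 ε - (a * ε + -c S.1 * ε ^ 2)| ≤ C * |ε ^ 3| := fun S => by
    obtain ⟨C, hC⟩ := (h S.1 S.2).bound
    exact ⟨C, by simpa only [Real.norm_eq_abs] using hC⟩
  choose C hC using h'
  refine IsBigO.of_bound (∑ S, |C S|) ?_
  filter_upwards [eventually_all.2 hC] with ε hε
  have hle : ∀ S : {S : Finset V // S.card = k}, |eigenvalueShift G S.1 ε - (a * ε + -c S.1 * ε ^ 2)| ≤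
      (∑ S, |C S|) * |ε ^ 3| := fun S =>
    (hε S).trans (mul_le_mul_of_nonneg_right ((le_abs_self _).trans
      (Finset.single_le_sum (f := fun S => |C S|) (fun _ _ => abs_nonneg _) (Finset.mem_univ S)))
      (abs_nonneg _))
  rw [Real.norm_eq_abs, Real.norm_eq_abs, abs_le]
  constructor
  · have h1 := (abs_le.1 (hle ⟨T, hT⟩)).1
    have h2 : eigenvalueShift G T ε ≤ optimalShift G k ε :=
      le_ciSup (f := fun S : {S : Finset V // S.card = k} => eigenvalueShift G S.1 ε)
        (Set.finite_range _).bddAbove ⟨T, hT⟩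
    linarith
  · have h1 : optimalShift G k ε ≤ (∑ S, |C S|) * |ε ^ 3| + (a * ε + -c T * ε ^ 2) := by
      refine ciSup_le fun S => ?_
      have h2 := (abs_le.1 (hle S)).2
      have h3 := mul_le_mul_of_nonneg_right (hmin S.1 S.2) (sq_nonneg ε)
      linarith
    linarith

/-! ### Poisson equation on the path -/

/-- The Laplacian of the path as a second difference. -/
theorem pathGraph_lapMatrix_mulVec (n : ℕ) (g : ℕ → ℝ) (i : Fin n) :
    ((SimpleGraph.pathGraph n).lapMatrix ℝ).mulVec (fun j => g j) i =
      (if (i : ℕ) + 1 < n then g i - g (i + 1) else 0) +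
        (if 0 < (i : ℕ) then g i - g (i - 1) else 0) := by
  have h1 : ((SimpleGraph.pathGraph n).lapMatrix ℝ).mulVec (fun j => g j) i =
      ∑ j : Fin n, ((if (i : ℕ) + 1 = j then g i - g j else 0) +
        if (j : ℕ) + 1 = i then g i - g j else 0) := by
    rw [SimpleGraph.lapMatrix_mulVec_apply, ← SimpleGraph.card_neighborFinset_eq_degree,
      ← nsmul_eq_mul, ← Finset.sum_const, ← Finset.sum_sub_distrib,
      SimpleGraph.neighborFinset_eq_filter, Finset.sum_filter]
    refine Finset.sum_congr rfl fun j _ => ?_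
    simp only [SimpleGraph.pathGraph_adj]
    split_ifs <;> first | omega | simp
  rw [h1, Finset.sum_add_distrib]
  congr 1
  · split_ifs with h
    · rw [Finset.sum_eq_single ⟨i + 1, h⟩]
      · simp
      · intro j _ hj
        rw [if_neg]
        intro h2
        exact hj (Fin.ext h2.symm)
      · simp
    · refine Finset.sum_eq_zero fun j _ => ?_
      rw [if_neg]
      have := j.2
      omega
  · split_ifs with h
    · rw [Finset.sum_eq_single ⟨i - 1, by omega⟩]
      · rw [if_pos]
        simp only
        omega
      · intro j _ hj
        rw [if_neg]
        intro h2
        exact hj (Fin.ext (by simp only; omega))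
      · simp
    · refine Finset.sum_eq_zero fun j _ => ?_
      rw [if_neg]
      omega

/-- The Poisson equation on the path: it is solved by the potential of the flow `Φ`. -/
theorem pathGraph_lapMatrix_mulVec_potential (n : ℕ) (Φ : ℕ → ℝ) (h0 : Φ 0 = 0) (hn : Φ n = 0)
    (d : ℝ) (i : Fin n) :
    ((SimpleGraph.pathGraph n).lapMatrix ℝ).mulVec
      (fun j => d - ∑ m ∈ Finset.range j, Φ (m + 1)) i = Φ (i + 1) - Φ i := by
  rw [pathGraph_lapMatrix_mulVec n (fun j => d - ∑ m ∈ Finset.range j, Φ (m + 1))]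
  obtain ⟨i, hi⟩ := i
  simp only
  have e1 : (if i + 1 < n then (d - ∑ m ∈ Finset.range i, Φ (m + 1)) -
      (d - ∑ m ∈ Finset.range (i + 1), Φ (m + 1)) else 0) = Φ (i + 1) := by
    split_ifs with h
    · rw [Finset.sum_range_succ]; ring
    · rw [show i + 1 = n by omega, hn]
  rw [e1]
  rcases i with _ | i
  · simp [h0]
  · rw [if_pos (Nat.succ_pos i), Nat.add_sub_cancel, Finset.sum_range_succ]
    ring

/-- Energy identity: summation by parts for the potential of the flow `Φ`. -/
theorem sum_range_diff_mul_potential (Φ : ℕ → ℝ) (h0 : Φ 0 = 0) (d : ℝ) (n : ℕ) :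
    ∑ i ∈ Finset.range n, (Φ (i + 1) - Φ i) * (d - ∑ m ∈ Finset.range i, Φ (m + 1)) =
      ∑ i ∈ Finset.range n, Φ (i + 1) ^ 2 +
        Φ n * (d - ∑ m ∈ Finset.range n, Φ (m + 1)) := by
  induction n with
  | zero => simp [h0]
  | succ n ih =>
    rw [Finset.sum_range_succ, ih, Finset.sum_range_succ _ n, Finset.sum_range_succ _ n]
    ring

/-- On the path, every vector of zero sum is in the range of the Laplacian. -/
theorem exists_pathGraph_lapMatrix_mulVec_eq {n : ℕ} (b : Fin n → ℝ) (hb : ∑ i, b i = 0) :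
    ∃ y : Fin n → ℝ, ∀ i, ((SimpleGraph.pathGraph n).lapMatrix ℝ).mulVec y i = b i := by
  set b' : ℕ → ℝ := fun i => if h : i < n then b ⟨i, h⟩ else 0 with hb'
  have hb'i : ∀ i : Fin n, b' i = b i := fun i => by simp [hb']
  refine ⟨_, fun i => (pathGraph_lapMatrix_mulVec_potential n
    (fun i => ∑ j ∈ Finset.range i, b' j) (by simp) ?_ 0 i).trans ?_⟩
  · rw [Finset.sum_range, ← hb]
    exact Finset.sum_congr rfl fun i _ => hb'i i
  · simp only [Finset.sum_range_succ, add_sub_cancel_left, hb'i]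

/-! ### Port energy and its minimisers -/

/-- The number of ports of `S` at or before position `i`. -/
def portCount {n : ℕ} (S : Finset (Fin n)) (i : ℕ) : ℕ :=
  (S.filter fun j : Fin n => (j : ℕ) ≤ i).card

/-- The imbalance of the ports `S`: `n²` times the energy of the flow that carries the ports to the
uniform distribution. -/
def portEnergy {n : ℕ} (S : Finset (Fin n)) : ℝ :=
  ∑ i ∈ Finset.range n, ((n : ℝ) * portCount S i - S.card * (i + 1)) ^ 2

theorem pathGraph_eigenvalueShift_hasSecondOrderApprox {n : ℕ} (hn : 0 < n) (S : Finset (Fin n)) :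
    HasSecondOrderApprox (eigenvalueShift (SimpleGraph.pathGraph n) S) (S.card / (n : ℝ))
      (-(portEnergy S / (n : ℝ) ^ 3)) := by
  have : Nonempty (Fin n) := ⟨⟨0, hn⟩⟩
  have hn0 : (n : ℝ) ≠ 0 := by positivity
  set a : ℝ := S.card / (n : ℝ) with ha
  -- The count here is strict, so `Φ (i + 1)` is the flow from `i` to `i + 1` and matches `portCount
  -- S i`.
  set Φ : ℕ → ℝ := fun i => ((S.filter fun j : Fin n => (j : ℕ) < i).card : ℝ) - a * i with hΦ
  have hΦ0 : Φ 0 = 0 := by simp [hΦ]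
  have hΦn : Φ n = 0 := by
    have : (S.filter fun j : Fin n => (j : ℕ) < n) = S :=
      Finset.filter_true_of_mem fun j _ => j.2
    simp only [hΦ, this, ha]
    field_simp
    ring
  have hdiff : ∀ i : Fin n, Φ (i + 1) - Φ i = (if i ∈ S then 1 else 0) - a := by
    intro i
    have h1 : ((S.filter fun j : Fin n => (j : ℕ) < i + 1).card : ℝ) =
        (S.filter fun j : Fin n => (j : ℕ) < i).card + if i ∈ S then 1 else 0 := by
      simp only [Finset.card_filter, Nat.cast_sum, Nat.cast_ite, Nat.cast_one, Nat.cast_zero]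
      rw [← Finset.sum_ite_eq' S i (fun _ => (1 : ℝ)), ← Finset.sum_add_distrib]
      refine Finset.sum_congr rfl fun j _ => ?_
      by_cases hj : j = i
      · subst hj; simp
      · have : (j : ℕ) ≠ i := fun h => hj (Fin.ext h)
        rw [if_neg hj, add_zero]
        congr 1
        exact propext (by omega)
    simp only [hΦ, h1]
    push_cast
    ring
  -- This constant makes `x` sum to zero, so the terms in `a * x` drop out of the sums below.
  set d : ℝ := (∑ i ∈ Finset.range n, ∑ m ∈ Finset.range i, Φ (m + 1)) / n with hd
  set x : ℕ → ℝ := fun j => d - ∑ m ∈ Finset.range j, Φ (m + 1) with hxdef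
  have hx : ∀ i : Fin n, ((SimpleGraph.pathGraph n).lapMatrix ℝ).mulVec (fun j => x j) i =
      (if i ∈ S then 1 else 0) - a := fun i => by
    rw [← hdiff, ← pathGraph_lapMatrix_mulVec_potential n Φ hΦ0 hΦn d i]
  have hxsum : ∑ i : Fin n, x i = 0 := by
    rw [← Finset.sum_range x]
    simp only [hxdef, Finset.sum_sub_distrib, Finset.sum_const, Finset.card_range, nsmul_eq_mul, hd]
    field_simp
    ring
  have hE : ∑ i ∈ Finset.range n, Φ (i + 1) ^ 2 = portEnergy S / (n : ℝ) ^ 2 := by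
    rw [portEnergy, Finset.sum_div]
    refine Finset.sum_congr rfl fun i _ => ?_
    simp only [hΦ, portCount, Nat.lt_succ_iff, ha]
    push_cast
    field_simp
  have hSx : ∑ i : Fin n, (if i ∈ S then x i else 0) = portEnergy S / (n : ℝ) ^ 2 := by
    have h1 := sum_range_diff_mul_potential Φ hΦ0 d n
    rw [hΦn, zero_mul, add_zero, hE, Finset.sum_range] at h1
    rw [← h1]
    have h2 : ∑ i : Fin n, (if i ∈ S then x i else 0) =
        ∑ i : Fin n, (if i ∈ S then x i else 0) - a * ∑ i : Fin n, x i := by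
      rw [hxsum]; ring
    rw [h2, Finset.mul_sum, ← Finset.sum_sub_distrib]
    refine Finset.sum_congr rfl fun i _ => ?_
    rw [hdiff]
    split_ifs <;> ring
  -- Solvability requires a zero-sum right-hand side, which forces `c = portEnergy S / n ^ 3`.
  obtain ⟨y, hy⟩ := exists_pathGraph_lapMatrix_mulVec_eq
    (fun i : Fin n => (if i ∈ S then x i else 0) - portEnergy S / (n : ℝ) ^ 3 - a * x i) (by
      rw [Finset.sum_sub_distrib, Finset.sum_sub_distrib, hSx, ← Finset.mul_sum, hxsum]
      simp only [Finset.sum_const, Finset.card_univ, Fintype.card_fin, nsmul_eq_mul]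
      field_simp
      ring)
  exact eigenvalueShift_hasSecondOrderApprox _ S a _ (fun j => x j) y hx hy

/-- Ports whose counts round the uniform distribution have the least energy. -/
theorem portEnergy_le_of_balanced {n : ℕ} (S T : Finset (Fin n)) (hcard : S.card = T.card)
    (hT : ∀ i < n, |2 * ((n : ℤ) * portCount T i - T.card * (i + 1))| ≤ n) :
    portEnergy T ≤ portEnergy S := by
  refine Finset.sum_le_sum fun i hi => ?_
  have h := abs_le.1 (hT i (Finset.mem_range.1 hi))
  rw [hcard]
  have key : ((n : ℤ) * portCount T i - T.card * (i + 1)) ^ 2 ≤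
      ((n : ℤ) * portCount S i - T.card * (i + 1)) ^ 2 := by
    generalize (T.card : ℤ) * (i + 1) = z at *
    generalize (portCount T i : ℤ) = t at *
    generalize (portCount S i : ℤ) = s at *
    have hn : (0 : ℤ) ≤ n := by positivity
    -- If the integers `s` and `t` differ, `n * s - z` is at least `n` away from `n * t - z`, which
    -- lies within `n / 2` of zero.
    rw [sq_le_sq, abs_le]
    rcases lt_trichotomy s t with hst | hst | hst
    · have h1 : (n : ℤ) * (s + 1) ≤ n * t := mul_le_mul_of_nonneg_left hst hn
      have h2 := neg_abs_le ((n : ℤ) * s - z)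
      have h3 := neg_le_abs ((n : ℤ) * s - z)
      constructor <;> linarith
    · subst hst
      exact ⟨neg_abs_le _, le_abs_self _⟩
    · have h1 : (n : ℤ) * (t + 1) ≤ n * s := mul_le_mul_of_nonneg_left hst hn
      have h3 := le_abs_self ((n : ℤ) * s - z)
      constructor <;> linarith
  exact_mod_cast key

theorem pathGraph_optimalShift_hasSecondOrderApprox {n : ℕ} (hn : 0 < n) (T : Finset (Fin n))
    (hT : ∀ i < n, |2 * ((n : ℤ) * portCount T i - T.card * (i + 1))| ≤ n) :
    HasSecondOrderApprox (optimalShift (SimpleGraph.pathGraph n) T.card) (T.card / (n : ℝ))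
      (-(portEnergy T / (n : ℝ) ^ 3)) :=
  optimalShift_hasSecondOrderApprox _ _ _ (fun S => portEnergy S / (n : ℝ) ^ 3)
    (fun S hS => hS ▸ pathGraph_eigenvalueShift_hasSecondOrderApprox hn S) T rfl
    (fun S hS => div_le_div_of_nonneg_right (portEnergy_le_of_balanced S T hS hT) (by positivity))

/-! ### Closed forms for the energies -/

theorem sum_range_succ_sq_real (n : ℕ) :
    ∑ i ∈ Finset.range n, ((i : ℝ) + 1) ^ 2 = (n : ℝ) * (n + 1) * (2 * n + 1) / 6 := by
  induction n with
  | zero => simp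
  | succ n ih => rw [Finset.sum_range_succ, ih]; push_cast; ring

theorem sum_range_ite_le_affine (p q : ℝ) (s m : ℕ) :
    ∑ i ∈ Finset.range (s + m), (if s ≤ i then p - q * (i + 1) else 0) =
      p * m - q * (s * m + m * (m + 1) / 2) := by
  induction m with
  | zero =>
    rw [Finset.sum_eq_zero fun i hi => if_neg (by have := Finset.mem_range.1 hi; omega)]
    simp
  | succ m ih =>
    rw [← add_assoc, Finset.sum_range_succ, ih, if_pos (Nat.le_add_right s m)]
    push_cast
    ring

theorem portCount_singleton {n : ℕ} (s : Fin n) (i : ℕ) :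
    portCount {s} i = if (s : ℕ) ≤ i then 1 else 0 := by
  rw [portCount, Finset.card_filter, Finset.sum_singleton]

theorem portCount_pair {n : ℕ} {s t : Fin n} (hst : s ≠ t) (i : ℕ) :
    portCount {s, t} i = (if (s : ℕ) ≤ i then 1 else 0) + if (t : ℕ) ≤ i then 1 else 0 := by
  rw [portCount, Finset.card_filter, Finset.sum_pair hst]

theorem portEnergy_singleton {s m : ℕ} (hm : 0 < m) :
    portEnergy ({⟨s, by omega⟩} : Finset (Fin (s + m))) =
      (s + m) * ((s + m) + 1) * (2 * (s + m) + 1) / 6 +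
        (((s + m) ^ 2 : ℝ) * m - 2 * (s + m) * (s * m + m * (m + 1) / 2)) := by
  have h : ∀ i ∈ Finset.range (s + m),
      (((s + m : ℕ) : ℝ) * portCount ({⟨s, by omega⟩} : Finset (Fin (s + m))) i
        - ({⟨s, by omega⟩} : Finset (Fin (s + m))).card * (i + 1)) ^ 2 =
      ((i : ℝ) + 1) ^ 2 +
        if s ≤ i then ((s + m : ℝ) ^ 2) - 2 * (s + m) * (i + 1) else 0 := by
    intro i _
    rw [portCount_singleton, Finset.card_singleton]
    simp only
    split_ifs <;> push_cast <;> ring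
  rw [portEnergy, Finset.sum_congr rfl h, Finset.sum_add_distrib, sum_range_succ_sq_real,
    sum_range_ite_le_affine]
  push_cast
  ring

theorem portEnergy_pair {n s t l m : ℕ} (hm : 0 < m) (hst : s < t) (hs : n = s + l)
    (ht : n = t + m) :
    portEnergy ({⟨s, by omega⟩, ⟨t, by omega⟩} : Finset (Fin n)) =
      4 * (n * (n + 1) * (2 * n + 1) / 6) +
        ((n ^ 2 : ℝ) * l - 4 * n * (s * l + l * (l + 1) / 2)) +
        ((3 * n ^ 2 : ℝ) * m - 4 * n * (t * m + m * (m + 1) / 2)) := by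
  have hne : (⟨s, by omega⟩ : Fin n) ≠ ⟨t, by omega⟩ := fun h => by
    have := congrArg Fin.val h
    simp only at this
    omega
  -- With port count `k`, the square is `4(i+1)² + k²n² - 4kn(i+1)`; as `k` goes 0, 1, 2, `k²` grows
  -- by 1 and then by 3.
  have h : ∀ i ∈ Finset.range n,
      ((n : ℝ) * portCount ({⟨s, by omega⟩, ⟨t, by omega⟩} : Finset (Fin n)) i
        - ({⟨s, by omega⟩, ⟨t, by omega⟩} : Finset (Fin n)).card * (i + 1)) ^ 2 =
      4 * ((i : ℝ) + 1) ^ 2 + (if s ≤ i then ((n : ℝ) ^ 2) - 4 * n * (i + 1) else 0) +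
        if t ≤ i then (3 * (n : ℝ) ^ 2) - 4 * n * (i + 1) else 0 := by
    intro i _
    rw [portCount_pair hne, Finset.card_pair hne]
    simp only
    split_ifs <;> first | omega | (push_cast; ring)
  rw [portEnergy, Finset.sum_congr rfl h, Finset.sum_add_distrib, Finset.sum_add_distrib,
    ← Finset.mul_sum, sum_range_succ_sq_real]
  congr 1
  · congr 1
    rw [hs, sum_range_ite_le_affine]
  · rw [ht, sum_range_ite_le_affine]

/-! ### Explicit coefficients and comparison -/

theorem eventually_two_mul_lt_of_hasSecondOrderApprox {f g : ℝ → ℝ} {b a₁ a₂ : ℝ}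
    (hf : HasSecondOrderApprox f b (-a₁)) (hg : HasSecondOrderApprox g (2 * b) (-a₂))
    (h : a₂ < 2 * a₁) : ∀ᶠ ε in 𝓝[≠] (0 : ℝ), 2 * f ε < g ε := by
  obtain ⟨C, hC⟩ := hf.bound
  obtain ⟨D, hD⟩ := hg.bound
  have hlim : ∀ᶠ ε in 𝓝 (0 : ℝ), (D + 2 * C) * |ε| < 2 * a₁ - a₂ := by
    refine ContinuousAt.eventually_lt (by fun_prop) continuousAt_const ?_
    simpa using h
  filter_upwards [hC.filter_mono nhdsWithin_le_nhds, hD.filter_mono nhdsWithin_le_nhds,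
    hlim.filter_mono nhdsWithin_le_nhds, self_mem_nhdsWithin] with ε h1 h2 h3 h4
  rw [Real.norm_eq_abs, Real.norm_eq_abs, abs_pow] at h1 h2
  have h5 := (abs_le.1 h1).2
  have h6 := (abs_le.1 h2).1
  have h7 : 0 < |ε| ^ 2 := pow_pos (abs_pos.2 h4) 2
  have h8 := mul_lt_mul_of_pos_right h3 h7
  rw [sq_abs] at h8
  have h9 : |ε| ^ 3 = |ε| * ε ^ 2 := by rw [← sq_abs ε]; ring
  rw [h9] at h5 h6
  linarith

theorem pathGraph_optimalShift_one {n : ℕ} (hn : 3 ≤ n) :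
    ∃ a₁ : ℝ, HasSecondOrderApprox (optimalShift (SimpleGraph.pathGraph n) 1) (1 / (n : ℝ)) (-a₁) ∧
      (n % 2 = 1 → a₁ = ((n : ℝ) ^ 2 - 1) / (12 * (n : ℝ) ^ 2)) ∧
      (n % 2 = 0 → a₁ = ((n : ℝ) ^ 2 + 2) / (12 * (n : ℝ) ^ 2)) := by
  obtain ⟨s, m, hm, rfl, hsm⟩ : ∃ s m : ℕ, 0 < m ∧ n = s + m ∧ (m = s ∨ m = s + 1) :=
    ⟨n / 2, n - n / 2, by omega, by omega, by omega⟩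
  have hpos : (0 : ℝ) < (s : ℝ) + m := by
    have : (0 : ℝ) < m := by exact_mod_cast hm
    positivity
  refine ⟨portEnergy ({⟨s, by omega⟩} : Finset (Fin (s + m))) / ((s + m : ℕ) : ℝ) ^ 3,
    ?_, ?_, ?_⟩
  · have h := pathGraph_optimalShift_hasSecondOrderApprox (by omega)
      ({⟨s, by omega⟩} : Finset (Fin (s + m))) (fun i hi => by
        rw [portCount_singleton, Finset.card_singleton, abs_le]
        simp only
        split_ifs <;> push_cast <;> constructor <;> omega)
    rw [Finset.card_singleton, Nat.cast_one] at h
    exact h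
  · intro h
    obtain rfl : m = s + 1 := by omega
    rw [portEnergy_singleton hm]
    push_cast at hpos ⊢
    field_simp
    ring
  · intro h
    obtain rfl : m = s := by omega
    rw [portEnergy_singleton hm]
    push_cast at hpos ⊢
    field_simp
    ring

theorem pathGraph_optimalShift_two {n : ℕ} (hn : 3 ≤ n) :
    ∃ a₂ : ℝ, HasSecondOrderApprox (optimalShift (SimpleGraph.pathGraph n) 2) (2 / (n : ℝ)) (-a₂) ∧
      (n % 2 = 1 → a₂ = ((n : ℝ) ^ 2 - 1) / (12 * (n : ℝ) ^ 2)) ∧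
      (n % 4 = 2 → a₂ = ((n : ℝ) ^ 2 - 4) / (12 * (n : ℝ) ^ 2)) ∧
      (n % 4 = 0 → a₂ = ((n : ℝ) ^ 2 + 8) / (12 * (n : ℝ) ^ 2)) := by
  have hn0 : (n : ℝ) ≠ 0 := by positivity
  -- Rounded quarter points, counted from 0: the middles of the two halves.
  obtain ⟨s, hs⟩ : ∃ s, s = n / 4 := ⟨_, rfl⟩
  obtain ⟨t, ht⟩ : ∃ t, t = 3 * n / 4 := ⟨_, rfl⟩
  have hst : s < t := by omega
  have htn : t < n := by omega
  have hne : (⟨s, by omega⟩ : Fin n) ≠ ⟨t, htn⟩ := fun h => by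
    have := congrArg Fin.val h
    simp only at this
    omega
  have hE := portEnergy_pair (n := n) (m := n - t) (l := n - s) (by omega) hst (by omega) (by omega)
  rw [Nat.cast_sub htn.le, Nat.cast_sub (hst.trans htn).le] at hE
  refine ⟨portEnergy ({⟨s, by omega⟩, ⟨t, htn⟩} : Finset (Fin n)) / (n : ℝ) ^ 3, ?_, ?_⟩
  · have h := pathGraph_optimalShift_hasSecondOrderApprox (by omega)
      ({⟨s, by omega⟩, ⟨t, htn⟩} : Finset (Fin n)) (fun i hi => by
        rw [portCount_pair hne, Finset.card_pair hne, abs_le]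
        simp only
        split_ifs <;> push_cast <;> constructor <;> omega)
    rw [Finset.card_pair hne, Nat.cast_ofNat] at h
    exact h
  · rw [hE]
    refine ⟨fun h => ?_, fun h => ?_, fun h => ?_⟩
    · rcases (by omega : n % 4 = 1 ∨ n % 4 = 3) with h' | h'
      · have e1 : (n : ℝ) = 4 * s + 1 := by exact_mod_cast (by omega : n = 4 * s + 1)
        have e2 : (t : ℝ) = 3 * s := by exact_mod_cast (by omega : t = 3 * s)
        rw [e1] at hn0
        rw [e1, e2]
        field_simp
        ring
      · have e1 : (n : ℝ) = 4 * s + 3 := by exact_mod_cast (by omega : n = 4 * s + 3)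
        have e2 : (t : ℝ) = 3 * s + 2 := by exact_mod_cast (by omega : t = 3 * s + 2)
        rw [e1] at hn0
        rw [e1, e2]
        field_simp
        ring
    · have e1 : (n : ℝ) = 4 * s + 2 := by exact_mod_cast (by omega : n = 4 * s + 2)
      have e2 : (t : ℝ) = 3 * s + 1 := by exact_mod_cast (by omega : t = 3 * s + 1)
      rw [e1] at hn0
      rw [e1, e2]
      field_simp
      ring
    · have e1 : (n : ℝ) = 4 * s := by exact_mod_cast (by omega : n = 4 * s)
      have e2 : (t : ℝ) = 3 * s := by exact_mod_cast (by omega : t = 3 * s)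
      rw [e1] at hn0
      rw [e1, e2]
      field_simp
      ring

theorem mainTheorem6 (n : ℕ) (hn : 3 ≤ n) :
    ∃ a₁ a₂ : ℝ,
      -- second-order expansions of the optimal 1-port and 2-port shifts
      HasSecondOrderApprox (optimalShift (SimpleGraph.pathGraph n) 1) (1 / (n : ℝ)) (-a₁) ∧
      HasSecondOrderApprox (optimalShift (SimpleGraph.pathGraph n) 2) (2 / (n : ℝ)) (-a₂) ∧
      -- the exact second-order coefficients
      (n % 2 = 1 → a₁ = ((n : ℝ) ^ 2 - 1) / (12 * (n : ℝ) ^ 2)) ∧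
      (n % 2 = 0 → a₁ = ((n : ℝ) ^ 2 + 2) / (12 * (n : ℝ) ^ 2)) ∧
      (n % 2 = 1 → a₂ = ((n : ℝ) ^ 2 - 1) / (12 * (n : ℝ) ^ 2)) ∧
      (n % 4 = 2 → a₂ = ((n : ℝ) ^ 2 - 4) / (12 * (n : ℝ) ^ 2)) ∧
      (n % 4 = 0 → a₂ = ((n : ℝ) ^ 2 + 8) / (12 * (n : ℝ) ^ 2)) ∧
      -- up to second order, the 2-port shift exceeds twice the 1-port shift
      (∀ ε : ℝ, ε ≠ 0 →
        2 * (1 / (n : ℝ) * ε + -a₁ * ε ^ 2) < 2 / (n : ℝ) * ε + -a₂ * ε ^ 2) ∧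
      -- the difference is `ε² (n² + 2) / (12 n²)` up to an error of at most `ε² / (2 n²)`
      (∀ ε : ℝ,
        |(2 / (n : ℝ) * ε + -a₂ * ε ^ 2) - 2 * (1 / (n : ℝ) * ε + -a₁ * ε ^ 2)
            - ε ^ 2 * (((n : ℝ) ^ 2 + 2) / (12 * (n : ℝ) ^ 2))|
          ≤ ε ^ 2 / (2 * (n : ℝ) ^ 2)) ∧
      -- hence the shifts themselves satisfy the strict inequality for all small `ε ≠ 0`
      (∀ᶠ ε in 𝓝[≠] (0 : ℝ),
        2 * optimalShift (SimpleGraph.pathGraph n) 1 ε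
          < optimalShift (SimpleGraph.pathGraph n) 2 ε) := by
  obtain ⟨a₁, hf, h1, h2⟩ := pathGraph_optimalShift_one hn
  obtain ⟨a₂, hg, h3, h4, h5⟩ := pathGraph_optimalShift_two hn
  have hn3 : (3 : ℝ) ≤ n := by exact_mod_cast hn
  have hsq : (9 : ℝ) ≤ (n : ℝ) ^ 2 := by nlinarith
  -- `e` is -3, 6 or -6 by residue class. The bound 6 gives the error `ε²/(2n²)`, and `n² + 2 - 6 >
  -- 0` gives strictness.
  have hdiff : ∃ e : ℝ, |e| ≤ 6 ∧ 2 * a₁ - a₂ = ((n : ℝ) ^ 2 + 2 + e) / (12 * (n : ℝ) ^ 2) := by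
    rcases (by omega : n % 2 = 1 ∨ n % 4 = 2 ∨ n % 4 = 0) with h | h | h
    · exact ⟨-3, by norm_num, by rw [h1 h, h3 h]; field_simp; ring⟩
    · exact ⟨6, by norm_num, by rw [h2 (by omega), h4 h]; field_simp; ring⟩
    · exact ⟨-6, by norm_num, by rw [h2 (by omega), h5 h]; field_simp; ring⟩
  obtain ⟨e, he, hd⟩ := hdiff
  have hlt : a₂ < 2 * a₁ := by
    have : 0 < 2 * a₁ - a₂ := by
      rw [hd]
      have := (abs_le.1 he).1
      exact div_pos (by linarith) (by linarith)
    linarith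
  refine ⟨a₁, a₂, hf, hg, h1, h2, h3, h4, h5, fun ε hε => ?_, fun ε => ?_, ?_⟩
  · have := mul_lt_mul_of_pos_right hlt (pow_pos (abs_pos.2 hε) 2)
    rw [sq_abs] at this
    linarith [show 2 / (n : ℝ) * ε = 2 * (1 / (n : ℝ) * ε) by ring]
  · have h6 : (2 / (n : ℝ) * ε + -a₂ * ε ^ 2) - 2 * (1 / (n : ℝ) * ε + -a₁ * ε ^ 2)
        - ε ^ 2 * (((n : ℝ) ^ 2 + 2) / (12 * (n : ℝ) ^ 2)) =
        ε ^ 2 / (12 * (n : ℝ) ^ 2) * e := by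
      calc _ = ε ^ 2 * (2 * a₁ - a₂) - ε ^ 2 * (((n : ℝ) ^ 2 + 2) / (12 * (n : ℝ) ^ 2)) := by ring
        _ = _ := by rw [hd]; ring
    rw [h6, abs_mul, abs_of_nonneg (by positivity)]
    calc ε ^ 2 / (12 * (n : ℝ) ^ 2) * |e| ≤ ε ^ 2 / (12 * (n : ℝ) ^ 2) * 6 :=
          mul_le_mul_of_nonneg_left he (by positivity)
      _ = _ := by field_simp; ring
  · exact eventually_two_mul_lt_of_hasSecondOrderApprox hf
      (by rwa [show 2 * (1 / (n : ℝ)) = 2 / (n : ℝ) by ring]) hlt
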